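/- Let $\Phi(u)=\int_0^u\phi(t)\,dt$, $u\ge 0$, be a Young function: $\phi(0)=0$, $\phi(t)>0$ for $t>0$, $\phi$ is nondecreasing and right continuous on $[0,\infty)$, $\phi(t)\to\infty$ as $t\to\infty$, and there is $a>1$ with $u\phi(u)<a\Phi(u)$ for all $u>0$. Let $\Omega\subset\mathbb{R}^d$ be open, let $L_\Phi(\Omega)$ be the Orlicz space of (classes of) measurable $u:\Omega\to\mathbb{R}$ with $\int_\Omega\Phi(|u|)\,dx<\infty$, with the Luxemburg norm $\|u\|=\inf\{\lambda>0:\int_\Omega\Phi(|u|/\lambda)\,dx\le 1\}$, let $A\subset\Omega$, and let $\mathcal{A}(A)$ be the family of open subsets of $A$. Write $U'\subset\subset U$ if $\overline{U'}$ is compact and contained in $U$; a cut-off function between $U'$ and $U$ is a $\varphi\in C_0^\infty(\mathbb{R}^d)$ with $\operatorname{spt}\varphi\subset U$, $0\le\varphi\le1$ and $\varphi=1$ on $U'$. Let $(F_n)_{n>0}$ be a family of functionals $F_n:L_\Phi(\Omega)\times\mathcal{A}(A)\to[-\infty,\infty]$ (indexed by real $n>0$) that satisfies the fundamental $L_\Phi$-estimate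 as $n\to0$: for all $U,U',V\in\mathcal{A}(A)$ with $U'\subset\subset U$ and every $\sigma>0$ there are $M_\sigma>0$ and $n_\sigma>0$ such that for all $0<n\le n_\sigma$ and all $u,v\in L_\Phi(\Omega)$ there is a cut-off function $\varphi$ between $U'$ and $U$ with \[F_n(\varphi u+(1-\varphi)v,U'\cup V)\le(1+\sigma)\bigl(F_n(u,U)+F_n(v,V)\bigr)+M_\sigma\int_{(U\cap V)\setminus U'}\Phi(|u-v|)\,dx+\sigma ,\] whenever the sum $F_n(u,U)+F_n(v,V)$ is not of the form $\infty-\infty$. Let $(n_j)$ be a sequence of positive numbers converging to $0$, and put \[F'(u,U)=\inf\Bigl\{\liminf_{j\to\infty}F_{n_j}(u_j,U):u_j\to u\text{ in }L_\Phi(\Omega)\Bigr\},\qquad F''(u,U)=\inf\Bigl\{\limsup_{j\to\infty}F_{n_j}(u_j,U):u_j\to u\text{ in }L_\Phi(\Omega)\Bigr\}.\] Then for all $u\in L_\Phi(\Omega)$ and all $U,U',V\in\mathcal{A}(A)$ with $U'\subset\subset U$, \[F'(u,U'\cup V)\le F'(u,U)+F''(u,V)\qquad\text{and}\qquad F''(u,U'\cup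 V)\le F''(u,U)+F''(u,V),\] each inequality being claimed whenever its right-hand side is not of the form $\infty-\infty$. -/

import Mathlib

open MeasureTheory Filter Topology TopologicalSpace
open scoped ENNReal ContDiff

noncomputable section

/-- A Young function `Φ(u) = ∫₀ᵘ φ(t) dt` together with its density `φ`. Only the values on
`[0, ∞)` matter. -/
structure YoungFunction where
  /-- The function `Φ`. -/
  toFun : ℝ → ℝ
  /-- The density `φ`. -/
  density : ℝ → ℝ
  density_zero : density 0 = 0
  density_pos : ∀ t : ℝ, 0 < t → 0 < density t
  density_mono : MonotoneOn density (Set.Ici 0)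
  density_rightCont : ∀ t : ℝ, 0 ≤ t → ContinuousWithinAt density (Set.Ici t) t
  density_atTop : Tendsto density atTop atTop
  eq_integral : ∀ u : ℝ, 0 ≤ u → toFun u = ∫ t in (0 : ℝ)..u, density t
  growth : ∃ a : ℝ, 1 < a ∧ ∀ u : ℝ, 0 < u → u * density u < a * toFun u

namespace YoungFunction

instance : CoeFun YoungFunction (fun _ => ℝ → ℝ) := ⟨YoungFunction.toFun⟩

lemma monotoneOn (Φ : YoungFunction) : MonotoneOn Φ (Set.Ici 0) := by
  intro a ha b hb hab
  have ha0 : (0 : ℝ) ≤ a := ha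
  have hb0 : (0 : ℝ) ≤ b := hb
  have hint : ∀ c d : ℝ, 0 ≤ c → 0 ≤ d → IntervalIntegrable Φ.density volume c d := by
    intro c d hc hd
    refine MonotoneOn.intervalIntegrable (Φ.density_mono.mono ?_)
    intro x hx
    exact le_trans (le_min hc hd) hx.1
  have hadd := intervalIntegral.integral_add_adjacent_intervals
    (hint 0 a le_rfl ha0) (hint a b ha0 hb0)
  have hnn : 0 ≤ ∫ t in a..b, Φ.density t := by
    refine intervalIntegral.integral_nonneg hab ?_
    intro t ht
    rcases (ha0.trans ht.1).eq_or_lt with h | h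
    · rw [← h, Φ.density_zero]
    · exact (Φ.density_pos t h).le
  rw [Φ.eq_integral a ha0, Φ.eq_integral b hb0]
  linarith

lemma measurable_comp_abs (Φ : YoungFunction) : Measurable (fun x : ℝ => Φ |x|) := by
  have hm : Monotone (fun x : ℝ => Φ (max x 0)) := by
    intro a b hab
    exact Φ.monotoneOn (le_max_right a 0) (le_max_right b 0) (max_le_max_right 0 hab)
  have h := hm.measurable.comp (measurable_norm (α := ℝ))
  have he : (fun x : ℝ => Φ |x|) = (fun x : ℝ => Φ (max x 0)) ∘ norm := by
    funext x
    simp [Real.norm_eq_abs]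
  rw [he]
  exact h

end YoungFunction

/-- The Euclidean space `ℝᵈ`. -/
abbrev Euc (d : ℕ) : Type := EuclideanSpace ℝ (Fin d)

/-- Classes of measurable real functions on `Ω`, modulo equality a.e. in `Ω`. -/
abbrev MeasClass {d : ℕ} (Ω : Opens (Euc d)) : Type :=
  Euc d →ₘ[volume.restrict (Ω : Set (Euc d))] ℝ

/-- The modular `ρ(f, Φ, S) = ∫_S Φ(|f(x)|) dx`. -/
def orliczModular {d : ℕ} (Φ : YoungFunction) (S : Set (Euc d)) (f : Euc d → ℝ) : ℝ≥0∞ :=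
  ∫⁻ x in S, ENNReal.ofReal (Φ |f x|)

/-- The Luxemburg norm `inf {c > 0 : ∫_S Φ(|f(x)| / c) dx ≤ 1}`, with value `∞` when there is no
such `c` (which does not happen on the Orlicz space). -/
def luxemburgNorm {d : ℕ} (Φ : YoungFunction) (S : Set (Euc d)) (f : Euc d → ℝ) : ℝ≥0∞ :=
  ⨅ (c : ℝ) (_ : 0 < c ∧ orliczModular Φ S (fun x => f x / c) ≤ 1), ENNReal.ofReal c

/-- The Orlicz space `L_Φ(Ω)`: classes of measurable functions on `Ω` with
`∫_Ω Φ(|u|) dx < ∞`. -/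
def OrliczSpace {d : ℕ} (Φ : YoungFunction) (Ω : Opens (Euc d)) : Type :=
  {u : MeasClass Ω // orliczModular Φ (Ω : Set (Euc d)) u < ⊤}

/-- Norm convergence `u_j → u` in `L_Φ(Ω)`. -/
def OrliczTendsto {d : ℕ} {Φ : YoungFunction} {Ω : Opens (Euc d)}
    (u : ℕ → OrliczSpace Φ Ω) (u₀ : OrliczSpace Φ Ω) : Prop :=
  Tendsto (fun j => luxemburgNorm Φ (Ω : Set (Euc d)) ((u j).1 - u₀.1 : MeasClass Ω))
    atTop (𝓝 0)

/-- `U' ⊂⊂ U`: the closure of `U'` is compact and contained in `U`. -/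
def CompactlyContained {d : ℕ} (U' U : Opens (Euc d)) : Prop :=
  IsCompact (closure (U' : Set (Euc d))) ∧ closure (U' : Set (Euc d)) ⊆ (U : Set (Euc d))

/-- A cut-off function between `U'` and `U`. -/
structure CutOff {d : ℕ} (U' U : Opens (Euc d)) where
  /-- The underlying function. -/
  toFun : Euc d → ℝ
  smooth : ContDiff ℝ ∞ toFun
  compactSupport : HasCompactSupport toFun
  support_subset : tsupport toFun ⊆ (U : Set (Euc d))
  nonneg : ∀ x, 0 ≤ toFun x
  le_one : ∀ x, toFun x ≤ 1
  eq_one : ∀ x ∈ U', toFun x = 1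

/-- The class of a cut-off function on `Ω`. -/
def CutOff.toClass {d : ℕ} {U' U : Opens (Euc d)} (φ : CutOff U' U) (Ω : Opens (Euc d)) :
    MeasClass Ω :=
  AEEqFun.mk φ.toFun φ.smooth.continuous.aestronglyMeasurable

lemma CutOff.modular_blend_lt_top {d : ℕ} {Φ : YoungFunction} {Ω U' U : Opens (Euc d)}
    (φ : CutOff U' U) (u v : OrliczSpace Φ Ω) :
    orliczModular Φ (Ω : Set (Euc d))
      (φ.toClass Ω * u.1 + (1 - φ.toClass Ω) * v.1 : MeasClass Ω) < ⊤ := by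
  have hmeas : AEMeasurable (fun x => ENNReal.ofReal (Φ |u.1 x|))
      (volume.restrict (Ω : Set (Euc d))) :=
    (Φ.measurable_comp_abs.comp_aemeasurable u.1.aestronglyMeasurable.aemeasurable).ennreal_ofReal
  have hle : orliczModular Φ (Ω : Set (Euc d))
      (φ.toClass Ω * u.1 + (1 - φ.toClass Ω) * v.1 : MeasClass Ω) ≤
      orliczModular Φ (Ω : Set (Euc d)) u.1 + orliczModular Φ (Ω : Set (Euc d)) v.1 := by
    unfold orliczModular
    rw [← lintegral_add_left' hmeas]
    refine lintegral_mono_ae ?_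
    filter_upwards [AEEqFun.coeFn_add (φ.toClass Ω * u.1) ((1 - φ.toClass Ω) * v.1),
      AEEqFun.coeFn_mul (φ.toClass Ω) u.1, AEEqFun.coeFn_mul (1 - φ.toClass Ω) v.1,
      AEEqFun.coeFn_sub 1 (φ.toClass Ω),
      (AEEqFun.coeFn_one : ((1 : MeasClass Ω) : Euc d → ℝ) =ᵐ[_] 1),
      AEEqFun.coeFn_mk φ.toFun φ.smooth.continuous.aestronglyMeasurable] with x h1 h2 h3 h4 h5 h6
    have h6' : (φ.toClass Ω) x = φ.toFun x := h6
    simp only [h1, Pi.add_apply, h2, Pi.mul_apply, h3, h4, Pi.sub_apply, h5, Pi.one_apply, h6']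
    have p0 := φ.nonneg x
    have p1 := φ.le_one x
    have hb : |φ.toFun x * u.1 x + (1 - φ.toFun x) * v.1 x| ≤ max |u.1 x| |v.1 x| := by
      calc |φ.toFun x * u.1 x + (1 - φ.toFun x) * v.1 x|
          ≤ |φ.toFun x * u.1 x| + |(1 - φ.toFun x) * v.1 x| := abs_add_le _ _
        _ = φ.toFun x * |u.1 x| + (1 - φ.toFun x) * |v.1 x| := by
            rw [abs_mul, abs_mul, abs_of_nonneg p0, abs_of_nonneg (sub_nonneg.2 p1)]
        _ ≤ φ.toFun x * max |u.1 x| |v.1 x| + (1 - φ.toFun x) * max |u.1 x| |v.1 x| :=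
            add_le_add (mul_le_mul_of_nonneg_left (le_max_left _ _) p0)
              (mul_le_mul_of_nonneg_left (le_max_right _ _) (sub_nonneg.2 p1))
        _ = max |u.1 x| |v.1 x| := by ring
    rcases le_total |u.1 x| |v.1 x| with h | h
    · rw [max_eq_right h] at hb
      exact (ENNReal.ofReal_le_ofReal
        (Φ.monotoneOn (Set.mem_Ici.2 (abs_nonneg _)) (Set.mem_Ici.2 (abs_nonneg _)) hb)).trans le_add_self
    · rw [max_eq_left h] at hb
      exact (ENNReal.ofReal_le_ofReal
        (Φ.monotoneOn (Set.mem_Ici.2 (abs_nonneg _)) (Set.mem_Ici.2 (abs_nonneg _)) hb)).trans le_self_add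
  exact hle.trans_lt (ENNReal.add_lt_top.2 ⟨u.2, v.2⟩)

/-- The function `φ u + (1 - φ) v`, as an element of `L_Φ(Ω)`. -/
def CutOff.blend {d : ℕ} {Φ : YoungFunction} {Ω U' U : Opens (Euc d)}
    (φ : CutOff U' U) (u v : OrliczSpace Φ Ω) : OrliczSpace Φ Ω :=
  ⟨φ.toClass Ω * u.1 + (1 - φ.toClass Ω) * v.1, φ.modular_blend_lt_top u v⟩

/-- The sum `a + b` of extended reals is meaningful, i.e. not of the form `∞ - ∞`. -/
def SumDefined (a b : EReal) : Prop :=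
  ¬ (a = ⊤ ∧ b = ⊥) ∧ ¬ (a = ⊥ ∧ b = ⊤)

/-- The fundamental `L_Φ`-estimate for a family `(F_n)_{n > 0}` of functionals on
`L_Φ(Ω) × 𝒜(A)`, as `n → 0`, where `𝒜(A)` is the family of open subsets of `A`. The inequality is
only required for those `u`, `v` for which its right-hand side is meaningful. -/
def FundamentalEstimate {d : ℕ} {Φ : YoungFunction} {Ω : Opens (Euc d)} (A : Set (Euc d))
    (F : ℝ → OrliczSpace Φ Ω → Opens (Euc d) → EReal) : Prop :=
  ∀ U U' V : Opens (Euc d), (U : Set (Euc d)) ⊆ A → (U' : Set (Euc d)) ⊆ A →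
    (V : Set (Euc d)) ⊆ A → CompactlyContained U' U →
    ∀ σ : ℝ, 0 < σ → ∃ M : ℝ, 0 < M ∧ ∃ n₀ : ℝ, 0 < n₀ ∧ ∀ n : ℝ, 0 < n → n ≤ n₀ →
      ∀ u v : OrliczSpace Φ Ω, SumDefined (F n u U) (F n v V) →
        ∃ φ : CutOff U' U,
          F n (φ.blend u v) (U' ⊔ V) ≤
            ((1 + σ : ℝ) : EReal) * (F n u U + F n v V)
              + (M : EReal) * ((orliczModular Φ (((U : Set (Euc d)) ∩ V) \ U')
                  (u.1 - v.1 : MeasClass Ω) : ℝ≥0∞) : EReal)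
              + (σ : EReal)

/-- The `Γ(L_Φ)`-lower limit: the infimum of `liminf_j F_j(u_j)` over all `u_j → u` in
`L_Φ(Ω)`. -/
def gammaLiminf {d : ℕ} {Φ : YoungFunction} {Ω : Opens (Euc d)}
    (F : ℕ → OrliczSpace Φ Ω → EReal) (u : OrliczSpace Φ Ω) : EReal :=
  ⨅ (w : ℕ → OrliczSpace Φ Ω) (_ : OrliczTendsto w u), liminf (fun j => F j (w j)) atTop

/-- The `Γ(L_Φ)`-upper limit: the infimum of `limsup_j F_j(u_j)` over all `u_j → u` in
`L_Φ(Ω)`. -/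
def gammaLimsup {d : ℕ} {Φ : YoungFunction} {Ω : Opens (Euc d)}
    (F : ℕ → OrliczSpace Φ Ω → EReal) (u : OrliczSpace Φ Ω) : EReal :=
  ⨅ (w : ℕ → OrliczSpace Φ Ω) (_ : OrliczTendsto w u), limsup (fun j => F j (w j)) atTop

end

/-! Since `φ` is nondecreasing, `Φ` is convex. Hence the Luxemburg norm satisfies the triangle
inequality, and it dominates the modular wherever it is less than `1`. If `w_j → u` and `v_j → u`,
then any blend `φ w_j + (1 - φ) v_j` is within `‖w_j - u‖ + ‖v_j - u‖` of `u`, whatever the cut-off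
function, and the modular term of the fundamental estimate tends to `0`. Taking `w_j` and `v_j`
nearly optimal on `U` and on `V`, the blends are competitors on `U' ∪ V` whose energy is at most
`1 + σ` times the sum of the two, plus `2 σ`; then `σ → 0`. To stay clear of `∞ - ∞`, this is
carried out with real numbers `a`, `b` strictly above the two Γ-limits. -/

namespace YoungFunction

lemma map_zero (Φ : YoungFunction) : Φ 0 = 0 := by
  rw [Φ.eq_integral 0 le_rfl, intervalIntegral.integral_same]

lemma intervalIntegrable_density (Φ : YoungFunction) {a b : ℝ} (ha : 0 ≤ a) (hb : 0 ≤ b) :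
    IntervalIntegrable Φ.density volume a b :=
  (Φ.density_mono.mono fun _ hx => (le_min ha hb).trans hx.1).intervalIntegrable

lemma sub_eq_integral (Φ : YoungFunction) {a b : ℝ} (ha : 0 ≤ a) (hb : 0 ≤ b) :
    Φ b - Φ a = ∫ t in a..b, Φ.density t := by
  rw [Φ.eq_integral a ha, Φ.eq_integral b hb]
  exact intervalIntegral.integral_interval_sub_left (Φ.intervalIntegrable_density le_rfl hb)
    (Φ.intervalIntegrable_density le_rfl ha)

lemma density_mul_sub_le (Φ : YoungFunction) {x y : ℝ} (hx : 0 ≤ x) (hy : 0 ≤ y) :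
    Φ.density x * (y - x) ≤ Φ y - Φ x := by
  rcases le_total x y with hxy | hyx
  · calc Φ.density x * (y - x) = ∫ _ in x..y, Φ.density x := by
          rw [intervalIntegral.integral_const, smul_eq_mul, mul_comm]
      _ ≤ ∫ t in x..y, Φ.density t :=
          intervalIntegral.integral_mono_on hxy intervalIntegrable_const
            (Φ.intervalIntegrable_density hx hy) fun _ ht =>
              Φ.density_mono hx (hx.trans ht.1) ht.1
      _ = Φ y - Φ x := (Φ.sub_eq_integral hx hy).symm
  · have hle : Φ x - Φ y ≤ Φ.density x * (x - y) :=
      calc Φ x - Φ y = ∫ t in y..x, Φ.density t := Φ.sub_eq_integral hy hx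
        _ ≤ ∫ _ in y..x, Φ.density x :=
            intervalIntegral.integral_mono_on hyx (Φ.intervalIntegrable_density hy hx)
              intervalIntegrable_const fun _ ht => Φ.density_mono (hy.trans ht.1) hx ht.2
        _ = Φ.density x * (x - y) := by
            rw [intervalIntegral.integral_const, smul_eq_mul, mul_comm]
    linarith

lemma convexOn (Φ : YoungFunction) : ConvexOn ℝ (Set.Ici 0) Φ := by
  refine ⟨convex_Ici 0, fun x hx y hy a b ha hb hab => ?_⟩
  have hz : 0 ≤ a • x + b • y := convex_Ici (0 : ℝ) hx hy ha hb hab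
  set z := a • x + b • y with hz_def
  calc Φ z = (a + b) * Φ z + Φ.density z * (a * x + b * y - (a + b) * z) := by
        rw [hab, one_mul, one_mul, hz_def, smul_eq_mul, smul_eq_mul, sub_self, mul_zero, add_zero]
    _ = a * (Φ z + Φ.density z * (x - z)) + b * (Φ z + Φ.density z * (y - z)) := by ring
    _ ≤ a * Φ x + b * Φ y := by
        gcongr
        · linarith [Φ.density_mul_sub_le hz hx]
        · linarith [Φ.density_mul_sub_le hz hy]

end YoungFunction

section Modular

variable {d : ℕ} {Φ : YoungFunction} {S : Set (Euc d)} {f g : Euc d → ℝ}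

lemma orliczModular_mono_ae (h : ∀ᵐ x ∂volume.restrict S, |f x| ≤ |g x|) :
    orliczModular Φ S f ≤ orliczModular Φ S g :=
  lintegral_mono_ae <| h.mono fun _ hx =>
    ENNReal.ofReal_le_ofReal
      (Φ.monotoneOn (Set.mem_Ici.2 (abs_nonneg _)) (Set.mem_Ici.2 (abs_nonneg _)) hx)

lemma orliczModular_convexCombination_le (hf : AEMeasurable f (volume.restrict S)) {a b : ℝ}
    (ha : 0 ≤ a) (hb : 0 ≤ b) (hab : a + b = 1) :
    orliczModular Φ S (fun x => a * f x + b * g x) ≤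
      ENNReal.ofReal a * orliczModular Φ S f + ENNReal.ofReal b * orliczModular Φ S g := by
  have hmeas : AEMeasurable (fun x => ENNReal.ofReal (Φ |f x|)) (volume.restrict S) :=
    (Φ.measurable_comp_abs.comp_aemeasurable hf).ennreal_ofReal
  have hpointwise (x : Euc d) : Φ |a * f x + b * g x| ≤ a * Φ |f x| + b * Φ |g x| :=
    calc Φ |a * f x + b * g x| ≤ Φ (a * |f x| + b * |g x|) := by
          refine Φ.monotoneOn (Set.mem_Ici.2 (abs_nonneg _)) (Set.mem_Ici.2 (by positivity)) ?_
          refine (abs_add_le _ _).trans_eq ?_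
          rw [abs_mul, abs_mul, abs_of_nonneg ha, abs_of_nonneg hb]
      _ ≤ a * Φ |f x| + b * Φ |g x| :=
          Φ.convexOn.2 (abs_nonneg (f x)) (abs_nonneg (g x)) ha hb hab
  unfold orliczModular
  rw [← lintegral_const_mul' _ _ ENNReal.ofReal_ne_top,
    ← lintegral_const_mul' _ _ ENNReal.ofReal_ne_top, ← lintegral_add_left' (hmeas.const_mul _)]
  refine lintegral_mono fun x => ?_
  rw [← ENNReal.ofReal_mul ha, ← ENNReal.ofReal_mul hb]
  exact (ENNReal.ofReal_le_ofReal (hpointwise x)).trans ENNReal.ofReal_add_le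

lemma orliczModular_zero : orliczModular Φ S (fun _ => 0) = 0 := by
  simp only [orliczModular, abs_zero, Φ.map_zero, ENNReal.ofReal_zero, lintegral_zero]

lemma orliczModular_const_mul_le {c : ℝ} (hc : 0 ≤ c) (hc1 : c ≤ 1) :
    orliczModular Φ S (fun x => c * f x) ≤ ENNReal.ofReal c * orliczModular Φ S f := by
  simpa only [mul_zero, zero_add, orliczModular_zero] using
    orliczModular_convexCombination_le (Φ := Φ) (S := S) (f := fun _ => 0) (g := f)
      aemeasurable_const (sub_nonneg.2 hc1) hc (sub_add_cancel 1 c)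

end Modular

section Luxemburg

variable {d : ℕ} {Φ : YoungFunction} {S : Set (Euc d)} {f g h : Euc d → ℝ}

lemma luxemburgNorm_mono_ae (hfg : ∀ᵐ x ∂volume.restrict S, |f x| ≤ |g x|) :
    luxemburgNorm Φ S f ≤ luxemburgNorm Φ S g := by
  refine iInf₂_mono' fun c hc => ⟨c, ⟨hc.1, (orliczModular_mono_ae ?_).trans hc.2⟩, le_rfl⟩
  filter_upwards [hfg] with x hx
  rw [abs_div, abs_div]
  gcongr

lemma luxemburgNorm_abs : luxemburgNorm Φ S (fun x => |f x|) = luxemburgNorm Φ S f :=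
  le_antisymm (luxemburgNorm_mono_ae (.of_forall fun x => (abs_abs (f x)).le))
    (luxemburgNorm_mono_ae (.of_forall fun x => (abs_abs (f x)).ge))

lemma luxemburgNorm_add_le (hf : AEMeasurable f (volume.restrict S)) :
    luxemburgNorm Φ S (fun x => f x + g x) ≤ luxemburgNorm Φ S f + luxemburgNorm Φ S g := by
  refine ENNReal.le_iInf₂_add_iInf₂ fun a ha b hb => ?_
  obtain ⟨ha0, ha⟩ := ha
  obtain ⟨hb0, hb⟩ := hb
  have hab : a / (a + b) + b / (a + b) = 1 := by field_simp
  have hsplit : (fun x => (f x + g x) / (a + b)) =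
      fun x => a / (a + b) * (f x / a) + b / (a + b) * (g x / b) := by
    funext x
    field_simp
  rw [← ENNReal.ofReal_add ha0.le hb0.le]
  refine iInf₂_le (a + b) ⟨by positivity, ?_⟩
  calc orliczModular Φ S (fun x => (f x + g x) / (a + b))
      ≤ ENNReal.ofReal (a / (a + b)) * orliczModular Φ S (fun x => f x / a) +
          ENNReal.ofReal (b / (a + b)) * orliczModular Φ S (fun x => g x / b) := by
        rw [hsplit]
        exact orliczModular_convexCombination_le (hf.div_const a) (by positivity) (by positivity)
          hab
    _ ≤ ENNReal.ofReal (a / (a + b)) * 1 + ENNReal.ofReal (b / (a + b)) * 1 := by gcongr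
    _ = 1 := by
        rw [mul_one, mul_one, ← ENNReal.ofReal_add (by positivity) (by positivity), hab,
          ENNReal.ofReal_one]

lemma luxemburgNorm_le_add (hf : AEMeasurable f (volume.restrict S))
    (hle : ∀ᵐ x ∂volume.restrict S, |h x| ≤ |f x| + |g x|) :
    luxemburgNorm Φ S h ≤ luxemburgNorm Φ S f + luxemburgNorm Φ S g :=
  calc luxemburgNorm Φ S h ≤ luxemburgNorm Φ S (fun x => |f x| + |g x|) :=
        luxemburgNorm_mono_ae (hle.mono fun _ hx => hx.trans (le_abs_self _))
    _ ≤ luxemburgNorm Φ S (fun x => |f x|) + luxemburgNorm Φ S (fun x => |g x|) :=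
        luxemburgNorm_add_le hf.abs
    _ = luxemburgNorm Φ S f + luxemburgNorm Φ S g := by rw [luxemburgNorm_abs, luxemburgNorm_abs]

lemma orliczModular_le_luxemburgNorm (hf : luxemburgNorm Φ S f < 1) :
    orliczModular Φ S f ≤ luxemburgNorm Φ S f := by
  refine le_of_forall_gt_imp_ge_of_dense fun r hr => ?_
  have hlt := lt_min hr hf
  simp only [luxemburgNorm, iInf_lt_iff] at hlt
  obtain ⟨c, ⟨hc, hmod⟩, hcr⟩ := hlt
  have hc1 : c ≤ 1 := (ENNReal.ofReal_lt_one.1 (hcr.trans_le (min_le_right _ _))).le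
  calc orliczModular Φ S f = orliczModular Φ S (fun x => c * (f x / c)) := by
        simp only [mul_div_cancel₀ _ hc.ne']
    _ ≤ ENNReal.ofReal c * orliczModular Φ S (fun x => f x / c) :=
        orliczModular_const_mul_le hc.le hc1
    _ ≤ ENNReal.ofReal c := mul_le_of_le_one_right' hmod
    _ ≤ r := (hcr.trans_le (min_le_left _ _)).le

end Luxemburg

section OrliczSpace

variable {d : ℕ} {Φ : YoungFunction} {Ω : Opens (Euc d)}

lemma luxemburgNorm_sub_le_add (u v w : OrliczSpace Φ Ω) :
    luxemburgNorm Φ (Ω : Set (Euc d)) (u.1 - v.1 : MeasClass Ω) ≤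
      luxemburgNorm Φ (Ω : Set (Euc d)) (u.1 - w.1 : MeasClass Ω) +
        luxemburgNorm Φ (Ω : Set (Euc d)) (v.1 - w.1 : MeasClass Ω) := by
  refine luxemburgNorm_le_add (u.1 - w.1).aestronglyMeasurable.aemeasurable ?_
  filter_upwards [AEEqFun.coeFn_sub u.1 v.1, AEEqFun.coeFn_sub u.1 w.1,
    AEEqFun.coeFn_sub v.1 w.1] with x huv huw hvw
  rw [huv, huw, hvw]
  exact (abs_sub_le _ (w.1 x) _).trans_eq (by rw [abs_sub_comm (w.1 x)]; rfl)

lemma CutOff.coeFn_blend {U' U : Opens (Euc d)} (φ : CutOff U' U) (u v : OrliczSpace Φ Ω) :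
    (φ.blend u v).1 =ᵐ[volume.restrict (Ω : Set (Euc d))]
      fun x => φ.toFun x * u.1 x + (1 - φ.toFun x) * v.1 x := by
  have hφ : φ.toClass Ω =ᵐ[volume.restrict (Ω : Set (Euc d))] φ.toFun := AEEqFun.coeFn_mk _ _
  have hone : ((1 : MeasClass Ω) : Euc d → ℝ) =ᵐ[volume.restrict (Ω : Set (Euc d))] 1 :=
    AEEqFun.coeFn_one
  exact (AEEqFun.coeFn_add _ _).trans <| .add ((AEEqFun.coeFn_mul _ _).trans (hφ.mul .rfl))
    ((AEEqFun.coeFn_mul _ _).trans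
      (((AEEqFun.coeFn_sub _ _).trans (hone.sub hφ)).mul .rfl))

lemma CutOff.luxemburgNorm_blend_sub_le {U' U : Opens (Euc d)} (φ : CutOff U' U)
    (u v w : OrliczSpace Φ Ω) :
    luxemburgNorm Φ (Ω : Set (Euc d)) ((φ.blend u v).1 - w.1 : MeasClass Ω) ≤
      luxemburgNorm Φ (Ω : Set (Euc d)) (u.1 - w.1 : MeasClass Ω) +
        luxemburgNorm Φ (Ω : Set (Euc d)) (v.1 - w.1 : MeasClass Ω) := by
  refine luxemburgNorm_le_add (u.1 - w.1).aestronglyMeasurable.aemeasurable ?_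
  filter_upwards [φ.coeFn_blend u v, AEEqFun.coeFn_sub (φ.blend u v).1 w.1,
    AEEqFun.coeFn_sub u.1 w.1, AEEqFun.coeFn_sub v.1 w.1] with x hblend hbw huw hvw
  rw [hbw, huw, hvw, Pi.sub_apply, Pi.sub_apply, Pi.sub_apply, hblend]
  have hφ0 := φ.nonneg x
  have hφ1 := sub_nonneg.2 (φ.le_one x)
  calc |φ.toFun x * u.1 x + (1 - φ.toFun x) * v.1 x - w.1 x|
      = |φ.toFun x * (u.1 x - w.1 x) + (1 - φ.toFun x) * (v.1 x - w.1 x)| := by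
        congr 1
        ring
    _ ≤ φ.toFun x * |u.1 x - w.1 x| + (1 - φ.toFun x) * |v.1 x - w.1 x| := by
        refine (abs_add_le _ _).trans_eq ?_
        rw [abs_mul, abs_mul, abs_of_nonneg hφ0, abs_of_nonneg hφ1]
    _ ≤ |u.1 x - w.1 x| + |v.1 x - w.1 x| :=
        add_le_add (mul_le_of_le_one_left (abs_nonneg _) (φ.le_one x))
          (mul_le_of_le_one_left (abs_nonneg _) (sub_le_self 1 hφ0))

namespace OrliczTendsto

variable {u v w : ℕ → OrliczSpace Φ Ω} {u₀ : OrliczSpace Φ Ω}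

lemma tendsto_luxemburgNorm_add (hu : OrliczTendsto u u₀) (hv : OrliczTendsto v u₀) :
    Tendsto (fun j => luxemburgNorm Φ (Ω : Set (Euc d)) ((u j).1 - u₀.1 : MeasClass Ω) +
      luxemburgNorm Φ (Ω : Set (Euc d)) ((v j).1 - u₀.1 : MeasClass Ω)) atTop (𝓝 0) := by
  simpa only [add_zero] using Tendsto.add hu hv

lemma of_eventually_le_add (hu : OrliczTendsto u u₀) (hv : OrliczTendsto v u₀)
    (hw : ∀ᶠ j in atTop, luxemburgNorm Φ (Ω : Set (Euc d)) ((w j).1 - u₀.1 : MeasClass Ω) ≤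
      luxemburgNorm Φ (Ω : Set (Euc d)) ((u j).1 - u₀.1 : MeasClass Ω) +
        luxemburgNorm Φ (Ω : Set (Euc d)) ((v j).1 - u₀.1 : MeasClass Ω)) :
    OrliczTendsto w u₀ :=
  tendsto_of_tendsto_of_tendsto_of_le_of_le' tendsto_const_nhds (hu.tendsto_luxemburgNorm_add hv)
    (.of_forall fun _ => bot_le) hw

lemma tendsto_orliczModular_sub (hu : OrliczTendsto u u₀) (hv : OrliczTendsto v u₀)
    {S : Set (Euc d)} (hS : S ⊆ Ω) :
    Tendsto (fun j => orliczModular Φ S ((u j).1 - (v j).1 : MeasClass Ω)) atTop (𝓝 0) := by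
  have hadd := hu.tendsto_luxemburgNorm_add hv
  refine tendsto_of_tendsto_of_tendsto_of_le_of_le' tendsto_const_nhds hadd
    (.of_forall fun _ => bot_le) ?_
  filter_upwards [hadd.eventually_lt_const one_pos] with j hj
  have hnorm := luxemburgNorm_sub_le_add (u j) (v j) u₀
  exact (lintegral_mono_set hS).trans
    ((orliczModular_le_luxemburgNorm (hnorm.trans_lt hj)).trans hnorm)

end OrliczTendsto

end OrliczSpace

section GammaLimits

variable {d : ℕ} {Φ : YoungFunction} {Ω : Opens (Euc d)}
  {F : ℕ → OrliczSpace Φ Ω → EReal} {u : OrliczSpace Φ Ω} {a : EReal}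

lemma exists_frequently_lt_of_gammaLiminf_lt (h : gammaLiminf F u < a) :
    ∃ w, OrliczTendsto w u ∧ ∃ᶠ j in atTop, F j (w j) < a := by
  simp only [gammaLiminf, iInf_lt_iff] at h
  obtain ⟨w, hw, hlt⟩ := h
  exact ⟨w, hw, frequently_lt_of_liminf_lt (by isBoundedDefault) hlt⟩

lemma exists_eventually_lt_of_gammaLimsup_lt (h : gammaLimsup F u < a) :
    ∃ w, OrliczTendsto w u ∧ ∀ᶠ j in atTop, F j (w j) < a := by
  simp only [gammaLimsup, iInf_lt_iff] at h
  obtain ⟨w, hw, hlt⟩ := h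
  exact ⟨w, hw, eventually_lt_of_limsup_lt hlt⟩

lemma gammaLiminf_le_of_frequently_le {w : ℕ → OrliczSpace Φ Ω} (hw : OrliczTendsto w u)
    (h : ∃ᶠ j in atTop, F j (w j) ≤ a) : gammaLiminf F u ≤ a :=
  (iInf₂_le w hw).trans (liminf_le_of_frequently_le' h)

lemma gammaLimsup_le_of_eventually_le {w : ℕ → OrliczSpace Φ Ω} (hw : OrliczTendsto w u)
    (h : ∀ᶠ j in atTop, F j (w j) ≤ a) : gammaLimsup F u ≤ a :=
  (iInf₂_le w hw).trans (limsup_le_of_le (by isBoundedDefault) h)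

end GammaLimits

section ExtendedReals

variable {x a b : EReal}

lemma SumDefined.of_ne_top (ha : a ≠ ⊤) (hb : b ≠ ⊤) : SumDefined a b :=
  ⟨fun h => ha h.1, fun h => hb h.2⟩

lemma SumDefined.le_add_of_forall_lt (hab : SumDefined a b)
    (h : ∀ r s : ℝ, a < r → b < s → x ≤ ((r + s : ℝ) : EReal)) : x ≤ a + b := by
  refine EReal.le_add_of_forall_gt (not_and_or.1 hab.2) (not_and_or.1 hab.1)
    fun a' ha b' hb => ?_
  obtain ⟨r, har, hra'⟩ := EReal.lt_iff_exists_real_btwn.1 ha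
  obtain ⟨s, hbs, hsb'⟩ := EReal.lt_iff_exists_real_btwn.1 hb
  calc x ≤ ((r + s : ℝ) : EReal) := h r s har hbs
    _ = r + s := EReal.coe_add r s
    _ ≤ a' + b' := add_le_add hra'.le hsb'.le

lemma le_coe_of_forall_pos_le_one_add_mul_add {c : ℝ}
    (h : ∀ σ : ℝ, 0 < σ → x ≤ (((1 + σ) * c + 2 * σ : ℝ) : EReal)) : x ≤ c := by
  have hcont : Continuous fun σ : ℝ => (((1 + σ) * c + 2 * σ : ℝ) : EReal) :=
    continuous_coe_real_ereal.comp (by fun_prop)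
  have hlim : Tendsto (fun σ : ℝ => (((1 + σ) * c + 2 * σ : ℝ) : EReal)) (𝓝[>] 0) (𝓝 c) := by
    simpa only [add_zero, one_mul, mul_zero] using hcont.continuousWithinAt.tendsto (x := 0)
  exact ge_of_tendsto hlim (eventually_nhdsWithin_of_forall h)

lemma eventually_coe_mul_le_coe {ρ : ℕ → ℝ≥0∞} (hρ : Tendsto ρ atTop (𝓝 0)) {M σ : ℝ}
    (hM : 0 < M) (hσ : 0 < σ) : ∀ᶠ j in atTop, (M : EReal) * (ρ j : EReal) ≤ σ := by
  filter_upwards [hρ.eventually_le_const (ENNReal.ofReal_pos.2 (div_pos hσ hM))] with j hj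
  have hcoe : (ρ j : EReal) ≤ ((σ / M : ℝ) : EReal) := by
    simpa only [EReal.coe_ennreal_ofReal, max_eq_left (div_pos hσ hM).le] using
      EReal.coe_ennreal_le_coe_ennreal_iff.2 hj
  calc (M : EReal) * (ρ j : EReal) ≤ M * ((σ / M : ℝ) : EReal) :=
        mul_le_mul_of_nonneg_left hcoe (EReal.coe_nonneg.2 hM.le)
    _ = σ := by rw [← EReal.coe_mul, mul_div_cancel₀ _ hM.ne']

end ExtendedReals

section Gluing

variable {d : ℕ} {Φ : YoungFunction} {Ω : Opens (Euc d)}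

/-- Any two sequences converging to `u`, measured by `G` and by `H`, can be glued into one measured
by `K`. This is the asymptotic form of the fundamental estimate: its modular term is absorbed into
the error, whence `2 * σ`. -/
def GluesAt (G H K : ℕ → OrliczSpace Φ Ω → EReal) (u : OrliczSpace Φ Ω) : Prop :=
  ∀ σ : ℝ, 0 < σ → ∀ w v : ℕ → OrliczSpace Φ Ω, OrliczTendsto w u → OrliczTendsto v u →
    ∃ z : ℕ → OrliczSpace Φ Ω, OrliczTendsto z u ∧ ∀ᶠ j in atTop,
      SumDefined (G j (w j)) (H j (v j)) →
        K j (z j) ≤ ((1 + σ : ℝ) : EReal) * (G j (w j) + H j (v j)) + ((2 * σ : ℝ) : EReal)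

namespace GluesAt

variable {G H K : ℕ → OrliczSpace Φ Ω → EReal} {u : OrliczSpace Φ Ω}

lemma exists_eventually_le (hglue : GluesAt G H K u) {w v : ℕ → OrliczSpace Φ Ω}
    (hw : OrliczTendsto w u) (hv : OrliczTendsto v u) (a b : ℝ) {σ : ℝ} (hσ : 0 < σ) :
    ∃ z, OrliczTendsto z u ∧ ∀ᶠ j in atTop, G j (w j) < a → H j (v j) < b →
      K j (z j) ≤ (((1 + σ) * (a + b) + 2 * σ : ℝ) : EReal) := by
  obtain ⟨z, hz, hle⟩ := hglue σ hσ w v hw hv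
  refine ⟨z, hz, hle.mono fun j hj ha hb => ?_⟩
  calc K j (z j)
      ≤ ((1 + σ : ℝ) : EReal) * (G j (w j) + H j (v j)) + ((2 * σ : ℝ) : EReal) :=
        hj (.of_ne_top ha.ne_top hb.ne_top)
    _ ≤ ((1 + σ : ℝ) : EReal) * (a + b) + ((2 * σ : ℝ) : EReal) := by
        have : (0 : EReal) ≤ ((1 + σ : ℝ) : EReal) := EReal.coe_nonneg.2 (by positivity)
        gcongr
    _ = (((1 + σ) * (a + b) + 2 * σ : ℝ) : EReal) := by
        simp only [EReal.coe_add, EReal.coe_mul]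

theorem gammaLiminf_le_add (hglue : GluesAt G H K u)
    (hsum : SumDefined (gammaLiminf G u) (gammaLimsup H u)) :
    gammaLiminf K u ≤ gammaLiminf G u + gammaLimsup H u := by
  refine hsum.le_add_of_forall_lt fun a b ha hb =>
    le_coe_of_forall_pos_le_one_add_mul_add fun σ hσ => ?_
  obtain ⟨w, hw, hwa⟩ := exists_frequently_lt_of_gammaLiminf_lt ha
  obtain ⟨v, hv, hvb⟩ := exists_eventually_lt_of_gammaLimsup_lt hb
  obtain ⟨z, hz, hle⟩ := hglue.exists_eventually_le hw hv a b hσ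
  exact gammaLiminf_le_of_frequently_le hz <|
    (hwa.and_eventually (hvb.and hle)).mono fun _ h => h.2.2 h.1 h.2.1

theorem gammaLimsup_le_add (hglue : GluesAt G H K u)
    (hsum : SumDefined (gammaLimsup G u) (gammaLimsup H u)) :
    gammaLimsup K u ≤ gammaLimsup G u + gammaLimsup H u := by
  refine hsum.le_add_of_forall_lt fun a b ha hb =>
    le_coe_of_forall_pos_le_one_add_mul_add fun σ hσ => ?_
  obtain ⟨w, hw, hwa⟩ := exists_eventually_lt_of_gammaLimsup_lt ha
  obtain ⟨v, hv, hvb⟩ := exists_eventually_lt_of_gammaLimsup_lt hb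
  obtain ⟨z, hz, hle⟩ := hglue.exists_eventually_le hw hv a b hσ
  refine gammaLimsup_le_of_eventually_le hz ?_
  filter_upwards [hwa, hvb, hle] with j ha hb h using h ha hb

end GluesAt

theorem FundamentalEstimate.gluesAt {A : Set (Euc d)} (hA : A ⊆ (Ω : Set (Euc d)))
    {F : ℝ → OrliczSpace Φ Ω → Opens (Euc d) → EReal} (hF : FundamentalEstimate A F)
    {n : ℕ → ℝ} (hn_pos : ∀ j, 0 < n j) (hn : Tendsto n atTop (𝓝 0)) {U U' V : Opens (Euc d)}
    (hU : (U : Set (Euc d)) ⊆ A) (hU' : (U' : Set (Euc d)) ⊆ A) (hV : (V : Set (Euc d)) ⊆ A)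
    (hU'U : CompactlyContained U' U) (u : OrliczSpace Φ Ω) :
    GluesAt (fun j w => F (n j) w U) (fun j w => F (n j) w V)
      (fun j w => F (n j) w (U' ⊔ V)) u := by
  intro σ hσ w v hw hv
  obtain ⟨M, hM, n₀, hn₀, hest⟩ := hF U U' V hU hU' hV hU'U σ hσ
  have hmod := eventually_coe_mul_le_coe (hw.tendsto_orliczModular_sub hv
    (S := (U ∩ V : Set (Euc d)) \ U') fun _ hx => hA (hU hx.1.1)) hM hσ
  have hglue : ∀ᶠ j in atTop, ∃ z : OrliczSpace Φ Ω,
      luxemburgNorm Φ (Ω : Set (Euc d)) (z.1 - u.1 : MeasClass Ω) ≤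
        luxemburgNorm Φ (Ω : Set (Euc d)) ((w j).1 - u.1 : MeasClass Ω) +
          luxemburgNorm Φ (Ω : Set (Euc d)) ((v j).1 - u.1 : MeasClass Ω) ∧
      (SumDefined (F (n j) (w j) U) (F (n j) (v j) V) → F (n j) z (U' ⊔ V) ≤
        ((1 + σ : ℝ) : EReal) * (F (n j) (w j) U + F (n j) (v j) V) + ((2 * σ : ℝ) : EReal)) := by
    filter_upwards [hn.eventually_le_const hn₀, hmod] with j hj hmodj
    by_cases hsum : SumDefined (F (n j) (w j) U) (F (n j) (v j) V)
    · obtain ⟨φ, hφ⟩ := hest (n j) (hn_pos j) hj (w j) (v j) hsum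
      refine ⟨φ.blend (w j) (v j), φ.luxemburgNorm_blend_sub_le _ _ _, fun _ => hφ.trans ?_⟩
      refine (add_le_add_left (add_le_add_right hmodj _) _).trans_eq ?_
      rw [add_assoc, ← EReal.coe_add, ← two_mul]
    -- Here the estimate provides no cut-off function; `w j` itself keeps the sequence convergent.
    · exact ⟨w j, le_self_add, fun h => absurd h hsum⟩
  have : Nonempty (OrliczSpace Φ Ω) := ⟨u⟩
  obtain ⟨z, hz⟩ := hglue.choice
  exact ⟨z, hw.of_eventually_le_add hv (hz.mono fun _ h => h.1), hz.mono fun _ h => h.2⟩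

end Gluing

theorem proposition8 {d : ℕ} (Φ : YoungFunction) (Ω : Opens (Euc d)) (A : Set (Euc d))
    (hA : A ⊆ (Ω : Set (Euc d)))
    (F : ℝ → OrliczSpace Φ Ω → Opens (Euc d) → EReal)
    (hF : FundamentalEstimate A F)
    (n : ℕ → ℝ) (hn_pos : ∀ j, 0 < n j) (hn : Tendsto n atTop (𝓝 0))
    (F' F'' : OrliczSpace Φ Ω → Opens (Euc d) → EReal)
    (hF' : ∀ u U, F' u U = gammaLiminf (fun j w => F (n j) w U) u)
    (hF'' : ∀ u U, F'' u U = gammaLimsup (fun j w => F (n j) w U) u)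
    (u : OrliczSpace Φ Ω) (U U' V : Opens (Euc d))
    (hU : (U : Set (Euc d)) ⊆ A) (hU' : (U' : Set (Euc d)) ⊆ A) (hV : (V : Set (Euc d)) ⊆ A)
    (hU'U : CompactlyContained U' U) :
    (SumDefined (F' u U) (F'' u V) → F' u (U' ⊔ V) ≤ F' u U + F'' u V) ∧
    (SumDefined (F'' u U) (F'' u V) → F'' u (U' ⊔ V) ≤ F'' u U + F'' u V) := by
  have hglue := hF.gluesAt hA hn_pos hn hU hU' hV hU'U u
  simp only [hF', hF'']
  exact ⟨hglue.gammaLiminf_le_add, hglue.gammaLimsup_le_add⟩
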